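/- **Setting.** A tensor network is a finite hypergraph $G=(V,E)$; each hyperedge $e$ has a dimension size $s(e)\in\mathbb{Z}_{\ge1}$ and weight $w(e)=\log s(e)$. It is adjacent to a nonempty set of vertices and may in addition have a dangling end ("uncontracted"); a hyperedge without a dangling end is adjacent to at least two vertices. For an edge set $F\subseteq E$ and disjoint $A,B\subseteq V$, $\mathrm{cut}_F(A,B)$ is the total weight of the hyperedges of $F$ adjacent to both $A$ and $B$; $\mathrm{cut}_F(A)$ is the total weight of the hyperedges of $F$ adjacent to both $A$ and $V\setminus A$, or uncontracted and adjacent to vertices of $A$ only. A contraction tree of $W\subseteq V$ is a rooted binary tree whose leaves are labelled bijectively by $W$; each inner node is a contraction $(A,B)$ of the vertex sets below its two children. The cost of a contraction tree $T_B$ of $V$ is $\mathrm{cost}(T_B)=\sum_{(A,B)}\exp(\mathrm{cut}_E(A)+\mathrm{cut}_E(B)-\mathrm{cut}_E(A,B))$, the sum being over its contractions (classical dense matrix multiplication). A data network is joined to an embedding: $V=V_D\sqcup V_E$, and $E_E\subseteq E$ is the edge set of the embedding, which is a graph. Each $e\in E_E$ is an output edge (uncontracted, at one vertex of $V_E$),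 or joins two vertices of $V_E$, or is an edge to be sketched, joining a vertex of $V_D$ to one of $V_E$. All hyperedges in $E\setminus E_E$ are adjacent to vertices of $V_D$ only. Put $N_E=|V_E|$, and let $m$ be the output sketch size (the product of the sizes of the output edges). Order the vertices with $V_D$ before $V_E$, and direct each contracted edge of $E_E$ to its later end and each output edge outward. The effective sketch dimension of $v\in V_E$ is the product of the sizes of the edges directed out of $v$. For $c>0$, $\varepsilon>0$, $0<\delta<1$, the embedding satisfies the $(\varepsilon,\delta)$-accurate sufficient condition with constant $c$ if for some such order every $v\in V_E$ has effective sketch dimension at least $c\,N_E\log(1/\delta)/\varepsilon^2$. The data has uniform sketch dimensions if every vertex of $V_D$ is adjacent to an edge to be sketched and every edge to be sketched has size greater than $m$. A contraction tree $T_B$ of $V$ is constrained on a contraction tree $T_0$ of $V_D$ if for each contraction $(A,B)$ of $T_0$ there is a contraction $(\hat A,\hat B)$ of $T_B$ with $\hat A\cap V_D=A$ and $\hat B\cap V_D=B$ (the two inputs of a contraction are unordered). Let $(U_1,V_1),\dots,(U_{|V_D|-1},V_{|V_D|-1})$ be the contractions of $T_0$. With $R=E\setminus E_E$, put $$a_i=e^{\mathrm{cut}_R(U_i)-\mathrm{cut}_R(U_i,V_i)},\quad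 c_i=e^{\mathrm{cut}_R(V_i)-\mathrm{cut}_R(U_i,V_i)},\quad d_i=\frac{e^{\mathrm{cut}_R(U_i\cup V_i)}}{a_ic_i},\quad b_i=\frac{e^{\mathrm{cut}_R(U_i,V_i)}}{d_i},$$ $$y_i=a_ib_ic_id_i\,m^2+m^2d_i\sqrt{a_ib_ic_i\,m}\cdot\min(\sqrt{a_i},\sqrt{c_i}).$$ **Theorem.** For all $c,C>0$ there is $\kappa>0$, depending only on $c$ and $C$, such that the following holds. Let $\varepsilon>0$ and $0<\delta<1$. Let the data have uniform sketch dimensions, and let the embedding satisfy the $(\varepsilon,\delta)$-accurate sufficient condition with constant $c$ and have exactly one output edge, of size $m\le C\,N_E\log(1/\delta)/\varepsilon^2$. Let $T_0$ be a contraction tree of $V_D$, and $T_B$ a contraction tree of $V=V_D\sqcup V_E$ constrained on $T_0$. Then $m\ge c\,N_E\log(1/\delta)/\varepsilon^2$ and $$\mathrm{cost}(T_B)\ \ge\ \kappa\Big(\sum_{v\in V_D}\exp(\mathrm{cut}_E(\{v\}))\,m+\sum_{i=1}^{|V_D|-1}y_i\Big),$$ where $\exp(\mathrm{cut}_E(\{v\}))$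 is the size of the tensor at $v$. -/

import Mathlib

universe u v

/-- A tensor diagram: a finite hypergraph whose hyperedges `e` carry a dimension size `dim e ≥ 1`.
`ends e` is the set of vertices adjacent to `e`; the hyperedges in `uncontracted` have in addition a
dangling end. A hyperedge without a dangling end joins at least two vertices. -/
structure TensorNetwork (V : Type u) (E : Type v) where
  ends : E → Finset V
  uncontracted : Finset E
  dim : E → ℕ
  ends_nonempty : ∀ e, (ends e).Nonempty
  two_le_card_ends : ∀ e, e ∉ uncontracted → 2 ≤ (ends e).card
  dim_pos : ∀ e, 0 < dim e

namespace TensorNetwork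

variable {V : Type u} {E : Type v} [Fintype V] [DecidableEq V] [DecidableEq E]

/-- The weight of a hyperedge: the natural logarithm of its dimension size. -/
noncomputable def weight (G : TensorNetwork V E) (e : E) : ℝ := Real.log (G.dim e)

/-- `E(A, B)`: the hyperedges of the edge set `F` adjacent to both `A` and `B`. -/
def edgesBetween (G : TensorNetwork V E) (F : Finset E) (A B : Finset V) : Finset E :=
  F.filter fun e => (G.ends e ∩ A).Nonempty ∧ (G.ends e ∩ B).Nonempty

/-- `E(A, *)`: the uncontracted hyperedges of `F` adjacent to vertices of `A` only. -/
def openEdges (G : TensorNetwork V E) (F : Finset E) (A : Finset V) : Finset E :=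
  F.filter fun e => e ∈ G.uncontracted ∧ G.ends e ⊆ A

/-- `E(A) = E(A, V \ A) ∪ E(A, *)`, within the edge set `F`. -/
def boundary (G : TensorNetwork V E) (F : Finset E) (A : Finset V) : Finset E :=
  G.edgesBetween F A Aᶜ ∪ G.openEdges F A

/-- `cut(A, B)` in the hypergraph with edge set `F`. -/
noncomputable def cutBetween (G : TensorNetwork V E) (F : Finset E) (A B : Finset V) : ℝ :=
  ∑ e ∈ G.edgesBetween F A B, G.weight e

/-- `cut(A)` in the hypergraph with edge set `F`: the logarithm of the size of the tensor obtained
by contracting the vertices of `A`. -/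
noncomputable def cut (G : TensorNetwork V E) (F : Finset E) (A : Finset V) : ℝ :=
  ∑ e ∈ G.boundary F A, G.weight e

/-- The logarithm of the cost of contracting (by classical dense matrix multiplication) the tensors
represented by the disjoint vertex sets `A` and `B`. -/
noncomputable def logCost (G : TensorNetwork V E) (F : Finset E) (A B : Finset V) : ℝ :=
  G.cut F A + G.cut F B - G.cutBetween F A B

end TensorNetwork

/-- Rooted binary trees with leaves labelled by vertices. -/
inductive ContractionTree (V : Type u) where
  | leaf (x : V) : ContractionTree V
  | node (l r : ContractionTree V) : ContractionTree V

namespace ContractionTree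

variable {V : Type u} [DecidableEq V]

def leaves : ContractionTree V → List V
  | leaf x => [x]
  | node l r => l.leaves ++ r.leaves

/-- The vertex set whose contraction output is represented by the root of the tree. -/
def verts (T : ContractionTree V) : Finset V := T.leaves.toFinset

/-- `T` is a contraction tree of a tensor network with vertex set `W`: every vertex of `W` labels
exactly one leaf. -/
def IsTreeOf (T : ContractionTree V) (W : Finset V) : Prop :=
  T.leaves.Nodup ∧ T.verts = W

/-- The contractions `(A, B)` performed by the tree, one for each inner node, listed in a
topological order. -/
def contractions : ContractionTree V → List (Finset V × Finset V)
  | leaf _ => []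
  | node l r => l.contractions ++ r.contractions ++ [(l.verts, r.verts)]

/-- The tensors represented by `A` and `B` are contracted with each other in `T`; the two children
of a node are not ordered. -/
def Contracts (T : ContractionTree V) (A B : Finset V) : Prop :=
  (A, B) ∈ T.contractions ∨ (B, A) ∈ T.contractions

/-- `T` is constrained on the contraction tree `T₀` of the network with vertex set `W`. -/
def ConstrainedOn (T T₀ : ContractionTree V) (W : Finset V) : Prop :=
  ∀ A B : Finset V, T₀.Contracts A B →
    ∃ A' B' : Finset V, T.Contracts A' B' ∧ A' ∩ W = A ∧ B' ∩ W = B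

/-- The cost of contracting the tensor network `G` along the tree `T`. -/
noncomputable def cost {E : Type v} [Fintype V] [Fintype E] [DecidableEq E]
    (T : ContractionTree V) (G : TensorNetwork V E) : ℝ :=
  (T.contractions.map fun p => Real.exp (G.logCost Finset.univ p.1 p.2)).sum

end ContractionTree

/-- The overall tensor network `G = (G_D, G_E)` of a data tensor network and an embedding applied to
it. The vertex set is the disjoint union of the embedding vertices `embV` and the data vertices
`embVᶜ`; `embE` is the edge set of the embedding, including the edges joining it to the data.
The edges outside `embE` form an arbitrary hypergraph on the data vertices. The embedding is a graph:
each of its edges is either an output edge (uncontracted, at one embedding vertex), or an edge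
between two embedding vertices, or an edge to be sketched, joining a data vertex to an
embedding vertex. -/
structure SketchedNetwork (V : Type u) (E : Type v) [Fintype V] [DecidableEq V]
    extends TensorNetwork V E where
  embV : Finset V
  embE : Finset E
  ends_subset_data : ∀ e, e ∉ embE → ends e ⊆ embVᶜ
  ends_inter_embV : ∀ e ∈ embE, (ends e ∩ embV).Nonempty
  card_ends_output : ∀ e ∈ embE, e ∈ uncontracted → (ends e).card = 1
  card_ends_contracted : ∀ e ∈ embE, e ∉ uncontracted → (ends e).card = 2

namespace SketchedNetwork

variable {V : Type u} {E : Type v} [Fintype V] [DecidableEq V] [Fintype E] [DecidableEq E]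

/-- The data vertices `V_D`. -/
def dataV (G : SketchedNetwork V E) : Finset V := G.embVᶜ

/-- The set of edges to be sketched: the edges joining the data to the embedding. -/
def sketchEdges (G : SketchedNetwork V E) : Finset E :=
  G.embE.filter fun e => (G.ends e ∩ G.dataV).Nonempty

/-- The output sketch dimensions: the uncontracted edges of the embedding. -/
def outputEdges (G : SketchedNetwork V E) : Finset E :=
  G.embE.filter fun e => e ∈ G.uncontracted

/-- The output sketch size `m`. -/
def sketchSize (G : SketchedNetwork V E) : ℕ := ∏ e ∈ G.outputEdges, G.dim e

/-- The edges of `R`: the data edges that are not to be sketched. -/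
def dataOnlyEdges (G : SketchedNetwork V E) : Finset E := G.embEᶜ

/-- Vertex orderings defining the sketching linearizations: the data vertices come before the
embedding vertices. -/
def IsSketchOrder (G : SketchedNetwork V E) (pos : V → ℕ) : Prop :=
  Function.Injective pos ∧ ∀ x ∈ G.dataV, ∀ y ∈ G.embV, pos x < pos y

/-- The embedding edges directed out of `x` in the linearization given by `pos`: contracted edges are
directed towards the later end, uncontracted edges away from their vertex. -/
def outEdges (G : SketchedNetwork V E) (pos : V → ℕ) (x : V) : Finset E :=
  G.embE.filter fun e =>
    x ∈ G.ends e ∧ (e ∈ G.uncontracted ∨ ∃ y ∈ G.ends e, pos x < pos y)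

/-- The effective sketch dimension of an embedding vertex: the row size of its matricization in the
linearization given by `pos`. -/
def effSketchDim (G : SketchedNetwork V E) (pos : V → ℕ) (x : V) : ℕ :=
  ∏ e ∈ G.outEdges pos x, G.dim e

/-- The quantity `N_E log(1/δ) / ε²`. -/
noncomputable def accuracyScale (G : SketchedNetwork V E) (ε δ : ℝ) : ℝ :=
  (G.embV.card : ℝ) * Real.log (1 / δ) / ε ^ 2

/-- The `(ε, δ)`-accurate sufficient condition, with implied constant `c`: in some linearization,
every embedding tensor has row size at least `c N_E log(1/δ) / ε²`. -/
def SufficientCondition (G : SketchedNetwork V E) (c ε δ : ℝ) : Prop :=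
  ∃ pos : V → ℕ, G.IsSketchOrder pos ∧
    ∀ x ∈ G.embV, c * G.accuracyScale ε δ ≤ (G.effSketchDim pos x : ℝ)

/-- Uniform sketch dimensions: every data vertex is adjacent to an edge to be sketched, and all edges
to be sketched have size greater than the sketch size. -/
def UniformSketchDims (G : SketchedNetwork V E) : Prop :=
  (∀ x ∈ G.dataV, ∃ e ∈ G.sketchEdges, x ∈ G.ends e) ∧
    ∀ e ∈ G.sketchEdges, G.sketchSize < G.dim e

/-- `a` for the contraction `(A, B)` (and `c`, when used for `(B, A)`). -/
noncomputable def sizeLeft (G : SketchedNetwork V E) (A B : Finset V) : ℝ :=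
  Real.exp (G.cut G.dataOnlyEdges A - G.cutBetween G.dataOnlyEdges A B)

/-- `d`: the size of the remaining dimensions adjacent to both `A` and `B`. -/
noncomputable def sizeShared (G : SketchedNetwork V E) (A B : Finset V) : ℝ :=
  Real.exp (G.cut G.dataOnlyEdges (A ∪ B)) / (G.sizeLeft A B * G.sizeLeft B A)

/-- `b`: the size of the dimensions contracted between `A` and `B`. -/
noncomputable def sizeContracted (G : SketchedNetwork V E) (A B : Finset V) : ℝ :=
  Real.exp (G.cutBetween G.dataOnlyEdges A B) / G.sizeShared A B

/-- `y = a b c d m² + m² d √(a b c m) · min(√a, √c)` for the contraction `(A, B)`. -/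
noncomputable def sketchTerm (G : SketchedNetwork V E) (A B : Finset V) : ℝ :=
  let a := G.sizeLeft A B
  let b := G.sizeContracted A B
  let c := G.sizeLeft B A
  let d := G.sizeShared A B
  let m := (G.sketchSize : ℝ)
  a * b * c * d * m ^ 2
    + m ^ 2 * d * Real.sqrt (a * b * c * m) * min (Real.sqrt a) (Real.sqrt c)

end SketchedNetwork

/-! Direct the embedding edges by the order in the sufficient condition. The outflow of a vertex set
`A` consists of the embedding edges with tail in `A` that are output edges or have their head
outside `A`. Each edge has one tail, so disjoint sets have disjoint outflows. With `K = max 1 (C /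
c)`, every nonempty set has outflow of size at least `m / K`: if it meets the embedding, all edges
out of its last embedding vertex leave it; otherwise an edge to be sketched leaves it
(`sketchSize_le_outFlow`). The exponential cost of a contraction is the size of the union of the two
boundaries, hence at least the data part times both outflows. This yields `abcd m²`, and the leaf
terms are similar.

For the square-root term, let `(A, B)` be the contraction of `T` lying over one of `T₀`, let `x` be
the last embedding vertex of `A ∪ B`, say `x ∈ A`, and let `f` be the size of the outflow of `A ∪ B`
and `q` that of the edges flowing from `B` into `A`. Up to powers of `K`, consuming `A ∪ B` costs
`acd · f · m`, forming `A` costs `abd · q · m²`, and `f q ≥ m²`, because the edges out of `x` and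
the outflow of `B` are disjoint and all counted in `f` or `q`. The geometric mean of the two costs
no longer involves `f` and `q` and dominates the term (`sqrt_term_le`, `exists_forming_cost`,
`sketchTerm_le`).

A contraction of `T` may be used several times. Each use is charged to the data vertex set of one of
its inputs or of its output, so it is counted at most three times in each family of distinct data
sets (`sum_chargedCost_le`). -/

namespace ContractionTree

variable {V : Type u} [DecidableEq V]

/-! ### Contraction trees: nestedness, distinct nodes, parents and children -/

theorem verts_node (l r : ContractionTree V) : (node l r).verts = l.verts ∪ r.verts := by
  simp [verts, leaves]

theorem verts_leaf (x : V) : (leaf x).verts = {x} := by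
  simp [verts, leaves]

theorem verts_nonempty (T : ContractionTree V) : T.verts.Nonempty := by
  induction T with
  | leaf x => simp [verts_leaf]
  | node l r hl _ => rw [verts_node]; exact hl.mono Finset.subset_union_left

theorem nodup_leaves_node {l r : ContractionTree V} :
    (node l r).leaves.Nodup ↔
      l.leaves.Nodup ∧ r.leaves.Nodup ∧ Disjoint l.verts r.verts := by
  simp only [leaves, List.nodup_append', verts, List.disjoint_toFinset_iff_disjoint]

theorem mem_contractions_node {l r : ContractionTree V} {p : Finset V × Finset V} :
    p ∈ (node l r).contractions ↔
      p ∈ l.contractions ∨ p ∈ r.contractions ∨ p = (l.verts, r.verts) := by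
  simp [contractions]

theorem contraction_spec {T : ContractionTree V} (hT : T.leaves.Nodup) {p : Finset V × Finset V}
    (hp : p ∈ T.contractions) :
    p.1.Nonempty ∧ p.2.Nonempty ∧ Disjoint p.1 p.2 ∧ p.1 ⊆ T.verts ∧ p.2 ⊆ T.verts := by
  induction T with
  | leaf x => simp [contractions] at hp
  | node l r hl hr =>
    obtain ⟨h1, h2, h3⟩ := nodup_leaves_node.1 hT
    rw [verts_node]
    rcases mem_contractions_node.1 hp with h | h | rfl
    · obtain ⟨a, b, c, d, e⟩ := hl h1 h
      exact ⟨a, b, c, d.trans Finset.subset_union_left, e.trans Finset.subset_union_left⟩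
    · obtain ⟨a, b, c, d, e⟩ := hr h2 h
      exact ⟨a, b, c, d.trans Finset.subset_union_right, e.trans Finset.subset_union_right⟩
    · exact ⟨l.verts_nonempty, r.verts_nonempty, h3, Finset.subset_union_left,
        Finset.subset_union_right⟩

/-- A function of contractions that only takes nonempty values below the tree, and that separates
the root contraction from the others, is injective on the contractions. -/
theorem contractions_injOn (f : Finset V × Finset V → Finset V)
    (hne : ∀ p, p.1.Nonempty → p.2.Nonempty → (f p).Nonempty)
    (hsub : ∀ p, f p ⊆ p.1 ∪ p.2)
    (hroot : ∀ p q : Finset V × Finset V, p.1.Nonempty → p.2.Nonempty → Disjoint p.1 p.2 →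
      q.1.Nonempty → q.2.Nonempty → Disjoint q.1 q.2 →
      (p.1 ∪ p.2 ⊆ q.1 ∨ p.1 ∪ p.2 ⊆ q.2) → f p ≠ f q)
    {T : ContractionTree V} (hT : T.leaves.Nodup) :
    Set.InjOn f {p | p ∈ T.contractions} := by
  induction T with
  | leaf x => intro p hp; simp [contractions] at hp
  | node l r hl hr =>
    obtain ⟨h1, h2, h3⟩ := nodup_leaves_node.1 hT
    have key : ∀ p, p ∈ l.contractions ∨ p ∈ r.contractions → f p ≠ f (l.verts, r.verts) := by
      intro p hp
      rcases hp with hp | hp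
      · obtain ⟨a, b, c, d, e⟩ := contraction_spec h1 hp
        exact hroot p (l.verts, r.verts) a b c l.verts_nonempty r.verts_nonempty h3
          (Or.inl (Finset.union_subset d e))
      · obtain ⟨a, b, c, d, e⟩ := contraction_spec h2 hp
        exact hroot p (l.verts, r.verts) a b c l.verts_nonempty r.verts_nonempty h3
          (Or.inr (Finset.union_subset d e))
    have cross : ∀ p q, p ∈ l.contractions → q ∈ r.contractions → f p ≠ f q := by
      intro p q hp hq hpq
      obtain ⟨a, b, c, d, e⟩ := contraction_spec h1 hp
      obtain ⟨a', b', c', d', e'⟩ := contraction_spec h2 hq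
      obtain ⟨x, hx⟩ := hne p a b
      exact Finset.disjoint_left.1 h3 (Finset.union_subset d e (hsub p hx))
        (Finset.union_subset d' e' (hsub q (hpq ▸ hx)))
    intro p hp q hq hpq
    rcases mem_contractions_node.1 hp with hp | hp | rfl <;>
      rcases mem_contractions_node.1 hq with hq | hq | rfl
    · exact hl h1 hp hq hpq
    · exact absurd hpq (cross p q hp hq)
    · exact absurd hpq (key p (Or.inl hp))
    · exact absurd hpq.symm (cross q p hq hp)
    · exact hr h2 hp hq hpq
    · exact absurd hpq (key p (Or.inr hp))
    · exact absurd hpq.symm (key q (Or.inl hq))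
    · exact absurd hpq.symm (key q (Or.inr hq))
    · rfl

/-- A contraction below `q` lies inside a single input of `q`, whereas the output of `q` meets both.
This and the two analogues for inputs make the data sets charged in the final sum distinct. -/
theorem union_injOn {T : ContractionTree V} (hT : T.leaves.Nodup) :
    Set.InjOn (fun p : Finset V × Finset V => p.1 ∪ p.2) {p | p ∈ T.contractions} := by
  refine contractions_injOn _ (fun p h _ => h.mono Finset.subset_union_left)
    (fun p => subset_rfl) ?_ hT
  intro p q _ _ _ hq1 hq2 hq h heq
  rw [heq] at h
  obtain ⟨x, hx⟩ := hq1
  obtain ⟨y, hy⟩ := hq2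
  rcases h with h | h
  · exact Finset.disjoint_left.1 hq (h (Finset.mem_union_right _ hy)) hy
  · exact Finset.disjoint_left.1 hq hx (h (Finset.mem_union_left _ hx))

theorem fst_injOn {T : ContractionTree V} (hT : T.leaves.Nodup) :
    Set.InjOn (fun p : Finset V × Finset V => p.1) {p | p ∈ T.contractions} := by
  refine contractions_injOn _ (fun p h _ => h) (fun p => Finset.subset_union_left) ?_ hT
  intro p q _ hp2 hp hq1 _ hq h heq
  obtain ⟨x, hx⟩ := hq1
  obtain ⟨y, hy⟩ := hp2
  rcases h with h | h
  · have hy' := h (Finset.mem_union_right _ hy)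
    rw [← heq] at hy'
    exact Finset.disjoint_left.1 hp hy' hy
  · exact Finset.disjoint_left.1 hq hx (h (Finset.mem_union_left _ (heq ▸ hx)))

theorem snd_injOn {T : ContractionTree V} (hT : T.leaves.Nodup) :
    Set.InjOn (fun p : Finset V × Finset V => p.2) {p | p ∈ T.contractions} := by
  refine contractions_injOn _ (fun p _ h => h) (fun p => Finset.subset_union_right) ?_ hT
  intro p q hp1 _ hp _ hq2 hq h heq
  obtain ⟨x, hx⟩ := hq2
  obtain ⟨y, hy⟩ := hp1
  rcases h with h | h
  · exact Finset.disjoint_left.1 hq (h (Finset.mem_union_right _ (heq ▸ hx))) hx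
  · have hy' := h (Finset.mem_union_left _ hy)
    rw [← heq] at hy'
    exact Finset.disjoint_left.1 hp hy hy'

theorem nodup_contractions {T : ContractionTree V} (hT : T.leaves.Nodup) :
    T.contractions.Nodup := by
  induction T with
  | leaf x => simp [contractions]
  | node l r hl hr =>
    obtain ⟨h1, h2, h3⟩ := nodup_leaves_node.1 hT
    have hx : ∀ p ∈ l.contractions, p ∉ r.contractions := by
      intro p hp hq
      obtain ⟨⟨x, hx⟩, _, _, d, _⟩ := contraction_spec h1 hp
      obtain ⟨_, _, _, d', _⟩ := contraction_spec h2 hq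
      exact Finset.disjoint_left.1 h3 (d hx) (d' hx)
    have hl' : (l.verts, r.verts) ∉ l.contractions := by
      intro hp
      obtain ⟨_, ⟨x, hx⟩, _, _, e⟩ := contraction_spec h1 hp
      exact Finset.disjoint_left.1 h3 (e hx) hx
    have hr' : (l.verts, r.verts) ∉ r.contractions := by
      intro hp
      obtain ⟨⟨x, hx⟩, _, _, d, _⟩ := contraction_spec h2 hp
      exact Finset.disjoint_left.1 h3 hx (d hx)
    simp only [contractions, List.nodup_append', List.nodup_singleton, List.disjoint_singleton,
      List.mem_append, not_or]
    exact ⟨⟨hl h1, hr h2, fun p hp hq => hx p hp hq⟩, trivial, hl', hr'⟩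

/-- Every node other than the root is consumed by some contraction; this provides the contraction
that pays for a leaf, or for the output of another contraction. -/
theorem exists_parent {T : ContractionTree V} {N : Finset V}
    (hN : (∃ x ∈ T.verts, N = {x}) ∨ ∃ p ∈ T.contractions, N = p.1 ∪ p.2)
    (hne : N ≠ T.verts) : ∃ p ∈ T.contractions, p.1 = N ∨ p.2 = N := by
  induction T with
  | leaf x =>
    simp [contractions, verts_leaf] at hN hne
    exact absurd hN hne
  | node l r hl hr =>
    have cl : ((∃ x ∈ l.verts, N = {x}) ∨ ∃ p ∈ l.contractions, N = p.1 ∪ p.2) →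
        ∃ p ∈ (node l r).contractions, p.1 = N ∨ p.2 = N := by
      intro h
      by_cases e : N = l.verts
      · exact ⟨_, mem_contractions_node.2 (Or.inr (Or.inr rfl)), Or.inl e.symm⟩
      · obtain ⟨p, hp, h⟩ := hl h e
        exact ⟨p, mem_contractions_node.2 (Or.inl hp), h⟩
    have cr : ((∃ x ∈ r.verts, N = {x}) ∨ ∃ p ∈ r.contractions, N = p.1 ∪ p.2) →
        ∃ p ∈ (node l r).contractions, p.1 = N ∨ p.2 = N := by
      intro h
      by_cases e : N = r.verts
      · exact ⟨_, mem_contractions_node.2 (Or.inr (Or.inr rfl)), Or.inr e.symm⟩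
      · obtain ⟨p, hp, h⟩ := hr h e
        exact ⟨p, mem_contractions_node.2 (Or.inr (Or.inl hp)), h⟩
    rw [verts_node] at hN hne
    rcases hN with ⟨x, hx, h⟩ | ⟨p, hp, h⟩
    · rcases Finset.mem_union.1 hx with hx | hx
      · exact cl (Or.inl ⟨x, hx, h⟩)
      · exact cr (Or.inl ⟨x, hx, h⟩)
    · rcases mem_contractions_node.1 hp with hp | hp | rfl
      · exact cl (Or.inr ⟨p, hp, h⟩)
      · exact cr (Or.inr ⟨p, hp, h⟩)
      · exact absurd h hne

theorem verts_eq_singleton_or_union (T : ContractionTree V) :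
    (∃ x, T.verts = {x}) ∨ ∃ p ∈ T.contractions, T.verts = p.1 ∪ p.2 := by
  cases T with
  | leaf x => exact Or.inl ⟨x, verts_leaf x⟩
  | node l r =>
    exact Or.inr ⟨_, mem_contractions_node.2 (Or.inr (Or.inr rfl)), verts_node l r⟩

/-- An input that is not a leaf was formed by an earlier contraction, whose cost can then be used as
well. -/
theorem child_eq_singleton_or_union {T : ContractionTree V} {N : Finset V}
    {p : Finset V × Finset V} (hp : p ∈ T.contractions) (hN : p.1 = N ∨ p.2 = N) :
    (∃ x, N = {x}) ∨ ∃ q ∈ T.contractions, N = q.1 ∪ q.2 := by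
  induction T with
  | leaf x => simp [contractions] at hp
  | node l r hl hr =>
    have cl : ((∃ x, N = {x}) ∨ ∃ q ∈ l.contractions, N = q.1 ∪ q.2) →
        (∃ x, N = {x}) ∨ ∃ q ∈ (node l r).contractions, N = q.1 ∪ q.2 := by
      rintro (h | ⟨q, hq, h⟩)
      · exact Or.inl h
      · exact Or.inr ⟨q, mem_contractions_node.2 (Or.inl hq), h⟩
    have cr : ((∃ x, N = {x}) ∨ ∃ q ∈ r.contractions, N = q.1 ∪ q.2) →
        (∃ x, N = {x}) ∨ ∃ q ∈ (node l r).contractions, N = q.1 ∪ q.2 := by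
      rintro (h | ⟨q, hq, h⟩)
      · exact Or.inl h
      · exact Or.inr ⟨q, mem_contractions_node.2 (Or.inr (Or.inl hq)), h⟩
    rcases mem_contractions_node.1 hp with h | h | rfl
    · exact cl (hl h)
    · exact cr (hr h)
    · rcases hN with rfl | rfl
      · exact cl l.verts_eq_singleton_or_union
      · exact cr r.verts_eq_singleton_or_union

end ContractionTree

/-! ### Sizes of edge sets, boundaries and contraction costs -/

namespace TensorNetwork

variable {V : Type u} {E : Type v}

/-- The product of the dimension sizes of a set of hyperedges. -/
noncomputable def vol (G : TensorNetwork V E) (F : Finset E) : ℝ := ∏ e ∈ F, (G.dim e : ℝ)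

theorem one_le_dim (G : TensorNetwork V E) (e : E) : (1 : ℝ) ≤ G.dim e := by
  exact_mod_cast G.dim_pos e

theorem vol_pos (G : TensorNetwork V E) (F : Finset E) : 0 < G.vol F :=
  Finset.prod_pos fun e _ => zero_lt_one.trans_le (G.one_le_dim e)

theorem vol_mono (G : TensorNetwork V E) {F F' : Finset E} (h : F ⊆ F') : G.vol F ≤ G.vol F' :=
  Finset.prod_le_prod_of_subset_of_one_le h
    (fun e _ => zero_le_one.trans (G.one_le_dim e)) fun e _ _ => G.one_le_dim e

variable [DecidableEq V] in
theorem cutBetween_comm (G : TensorNetwork V E) (F : Finset E) (A B : Finset V) :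
    G.cutBetween F A B = G.cutBetween F B A := by
  simp only [cutBetween, edgesBetween, and_comm]

theorem vol_union [DecidableEq E] (G : TensorNetwork V E) {F F' : Finset E} (h : Disjoint F F') :
    G.vol (F ∪ F') = G.vol F * G.vol F' :=
  Finset.prod_union h

theorem vol_mul_le [DecidableEq E] (G : TensorNetwork V E) {F F' F'' : Finset E} (h : Disjoint F F')
    (h1 : F ⊆ F'') (h2 : F' ⊆ F'') : G.vol F * G.vol F' ≤ G.vol F'' := by
  rw [← G.vol_union h]
  exact G.vol_mono (Finset.union_subset h1 h2)

theorem dim_le_vol (G : TensorNetwork V E) {F : Finset E} {e : E} (h : e ∈ F) :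
    (G.dim e : ℝ) ≤ G.vol F := by
  simpa [vol] using G.vol_mono (Finset.singleton_subset_iff.2 h)

theorem exp_sum_weight (G : TensorNetwork V E) (F : Finset E) :
    Real.exp (∑ e ∈ F, G.weight e) = G.vol F := by
  rw [Real.exp_sum]
  refine Finset.prod_congr rfl fun e _ => ?_
  exact Real.exp_log (zero_lt_one.trans_le (G.one_le_dim e))

variable [Fintype V] [DecidableEq V] [DecidableEq E]

theorem mem_boundary (G : TensorNetwork V E) {F : Finset E} {A : Finset V} {e : E} :
    e ∈ G.boundary F A ↔ e ∈ F ∧ (∃ x ∈ G.ends e, x ∈ A) ∧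
      (e ∈ G.uncontracted ∨ ∃ y ∈ G.ends e, y ∉ A) := by
  obtain ⟨z, hz⟩ := G.ends_nonempty e
  simp only [boundary, edgesBetween, openEdges, Finset.mem_union, Finset.mem_filter,
    Finset.Nonempty, Finset.mem_inter, Finset.mem_compl, Finset.subset_iff]
  constructor
  · rintro (⟨h, ⟨x, hx⟩, y, hy⟩ | ⟨h, h', h2⟩)
    · exact ⟨h, ⟨x, hx⟩, Or.inr ⟨y, hy⟩⟩
    · exact ⟨h, ⟨z, hz, h2 hz⟩, Or.inl h'⟩
  · rintro ⟨h, ⟨x, hx⟩, h'⟩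
    by_cases hy : ∃ y ∈ G.ends e, y ∉ A
    · exact Or.inl ⟨h, ⟨x, hx⟩, hy⟩
    · rcases h' with h' | h'
      · right
        push Not at hy
        exact ⟨h, h', fun {y} => hy y⟩
      · exact absurd h' hy

theorem boundary_inter_boundary (G : TensorNetwork V E) (F : Finset E) {A B : Finset V}
    (h : Disjoint A B) : G.boundary F A ∩ G.boundary F B = G.edgesBetween F A B := by
  ext e
  simp only [Finset.mem_inter, mem_boundary, edgesBetween, Finset.mem_filter, Finset.Nonempty]
  constructor
  · rintro ⟨⟨h1, h2, -⟩, -, h3, -⟩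
    exact ⟨h1, h2, h3⟩
  · rintro ⟨h1, ⟨x, hx, hxA⟩, y, hy, hyB⟩
    exact ⟨⟨h1, ⟨x, hx, hxA⟩, Or.inr ⟨y, hy, Finset.disjoint_right.1 h hyB⟩⟩,
      h1, ⟨y, hy, hyB⟩, Or.inr ⟨x, hx, Finset.disjoint_left.1 h hxA⟩⟩

theorem exp_cut (G : TensorNetwork V E) (F : Finset E) (A : Finset V) :
    Real.exp (G.cut F A) = G.vol (G.boundary F A) := G.exp_sum_weight _

/-- Inclusion–exclusion: for disjoint `A` and `B` the edges common to both boundaries are exactly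
those between `A` and `B`. Lower bounds on costs thereby reduce to exhibiting disjoint edge sets
inside the two boundaries. -/
theorem exp_logCost (G : TensorNetwork V E) (F : Finset E) {A B : Finset V} (h : Disjoint A B) :
    Real.exp (G.logCost F A B) = G.vol (G.boundary F A ∪ G.boundary F B) := by
  rw [← exp_sum_weight]
  congr 1
  have := Finset.sum_union_inter (s₁ := G.boundary F A) (s₂ := G.boundary F B) (f := G.weight)
  rw [G.boundary_inter_boundary F h] at this
  simp only [logCost, cut, cutBetween]
  linarith

theorem cutBetween_le_cut (G : TensorNetwork V E) (F : Finset E) {A B : Finset V}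
    (h : Disjoint A B) : G.cutBetween F A B ≤ G.cut F A := by
  simp only [cutBetween, cut]
  rw [← G.boundary_inter_boundary F h]
  exact Finset.sum_le_sum_of_subset_of_nonneg Finset.inter_subset_left
    fun e _ _ => Real.log_nonneg (G.one_le_dim e)

theorem boundary_union_subset (G : TensorNetwork V E) (F : Finset E) (A B : Finset V) :
    G.boundary F (A ∪ B) ⊆ G.boundary F A ∪ G.boundary F B := by
  intro e
  simp only [Finset.mem_union, mem_boundary]
  grind

end TensorNetwork

/-! ### The directed embedding and its outflows -/

namespace SketchedNetwork

variable {V : Type u} {E : Type v} [Fintype V] [DecidableEq V]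

theorem mem_dataV (G : SketchedNetwork V E) {x : V} : x ∈ G.dataV ↔ x ∉ G.embV := by
  simp [dataV]

theorem exists_end_embV (G : SketchedNetwork V E) {e : E} (he : e ∈ G.embE) :
    ∃ z ∈ G.ends e, z ∈ G.embV := by
  simpa [Finset.Nonempty] using G.ends_inter_embV e he

theorem notMem_uncontracted (G : SketchedNetwork V E) {e : E} (he : e ∈ G.embE) {x y : V}
    (hx : x ∈ G.ends e) (hy : y ∈ G.ends e) (hxy : x ≠ y) : e ∉ G.uncontracted := by
  intro h
  exact hxy (Finset.card_le_one.1 (G.card_ends_output e he h).le x hx y hy)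

theorem eq_or_eq_of_mem_ends (G : SketchedNetwork V E) {e : E} (he : e ∈ G.embE) {x y z : V}
    (hx : x ∈ G.ends e) (hy : y ∈ G.ends e) (hxy : x ≠ y) (hz : z ∈ G.ends e) :
    z = x ∨ z = y := by
  have h2 := G.card_ends_contracted e he (G.notMem_uncontracted he hx hy hxy)
  by_contra! h
  have h3 : ({z, x, y} : Finset V).card ≤ (G.ends e).card := by
    apply Finset.card_le_card
    simp [Finset.insert_subset_iff, hx, hy, hz]
  rw [Finset.card_eq_three.2 ⟨z, x, y, h.1, h.2, hxy, rfl⟩] at h3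
  omega

theorem boundary_inter_dataV [Fintype E] [DecidableEq E] (G : SketchedNetwork V E)
    (A : Finset V) :
    G.boundary G.dataOnlyEdges (A ∩ G.dataV) = G.boundary G.dataOnlyEdges A := by
  ext e
  simp only [TensorNetwork.mem_boundary, dataOnlyEdges, Finset.mem_compl, Finset.mem_inter]
  have h := G.ends_subset_data e
  simp only [Finset.subset_iff] at h
  unfold dataV
  grind

theorem exists_last (G : SketchedNetwork V E) (pos : V → ℕ) {A : Finset V}
    (h : ∃ x ∈ A, x ∈ G.embV) :
    ∃ x ∈ A, x ∈ G.embV ∧ ∀ y ∈ A, y ∈ G.embV → pos y ≤ pos x := by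
  obtain ⟨z, hz, hzE⟩ := h
  obtain ⟨x, hx, hmax⟩ := (A ∩ G.embV).exists_max_image pos ⟨z, Finset.mem_inter.2 ⟨hz, hzE⟩⟩
  obtain ⟨hx1, hx2⟩ := Finset.mem_inter.1 hx
  exact ⟨x, hx1, hx2, fun y hy hyE => hmax y (Finset.mem_inter.2 ⟨hy, hyE⟩)⟩

variable [DecidableEq E]

/-- The embedding edges that leave the vertex set `A` in the linearization given by `pos`: the tail
is in `A`, and the edge is an output edge or has its head outside `A`. -/
def outFlow (G : SketchedNetwork V E) (pos : V → ℕ) (A : Finset V) : Finset E :=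
  G.embE.filter fun e =>
    ∃ x ∈ G.ends e, x ∈ A ∧ (e ∈ G.uncontracted ∨ ∃ y ∈ G.ends e, y ∉ A ∧ pos x < pos y)

theorem mem_outFlow (G : SketchedNetwork V E) {pos : V → ℕ} {A : Finset V} {e : E} :
    e ∈ G.outFlow pos A ↔ e ∈ G.embE ∧
      ∃ x ∈ G.ends e, x ∈ A ∧ (e ∈ G.uncontracted ∨ ∃ y ∈ G.ends e, y ∉ A ∧ pos x < pos y) := by
  simp [outFlow]

theorem mem_outEdges (G : SketchedNetwork V E) {pos : V → ℕ} {x : V} {e : E} :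
    e ∈ G.outEdges pos x ↔ e ∈ G.embE ∧
      x ∈ G.ends e ∧ (e ∈ G.uncontracted ∨ ∃ y ∈ G.ends e, pos x < pos y) := by
  simp [outEdges]

theorem effSketchDim_eq_vol (G : SketchedNetwork V E) (pos : V → ℕ) (x : V) :
    (G.effSketchDim pos x : ℝ) = G.vol (G.outEdges pos x) := by
  simp [effSketchDim, TensorNetwork.vol]

theorem sketchSize_eq_vol (G : SketchedNetwork V E) :
    (G.sketchSize : ℝ) = G.vol G.outputEdges := by
  simp [sketchSize, TensorNetwork.vol]

theorem sketchSize_pos (G : SketchedNetwork V E) : (0 : ℝ) < G.sketchSize := by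
  rw [sketchSize_eq_vol]; exact G.vol_pos _

/-- An edge in both outflows would have a tail in each of the disjoint sets; having only two ends,
it would be directed both ways. -/
theorem outFlow_disjoint (G : SketchedNetwork V E) (pos : V → ℕ) {A B : Finset V}
    (h : Disjoint A B) : Disjoint (G.outFlow pos A) (G.outFlow pos B) := by
  rw [Finset.disjoint_left]
  intro e hA hB
  obtain ⟨he, x, hx, hxA, hA⟩ := G.mem_outFlow.1 hA
  obtain ⟨-, y, hy, hyB, hB⟩ := G.mem_outFlow.1 hB
  have hxy : x ≠ y := by rintro rfl; exact Finset.disjoint_left.1 h hxA hyB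
  have hu := G.notMem_uncontracted he hx hy hxy
  obtain ⟨z, hz, hzA, hxz⟩ := hA.resolve_left hu
  obtain ⟨w, hw, hwB, hyw⟩ := hB.resolve_left hu
  rcases G.eq_or_eq_of_mem_ends he hx hy hxy hz with rfl | rfl
  · exact hzA hxA
  · rcases G.eq_or_eq_of_mem_ends he hx hy hxy hw with rfl | rfl
    · omega
    · exact hwB hyB

/-- The head of a contracted edge out of `x` comes after `x`. Neither an embedding vertex of `A` nor
any data vertex does, so the head is outside `A`. -/
theorem outEdges_subset_outFlow (G : SketchedNetwork V E) {pos : V → ℕ}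
    (hpos : G.IsSketchOrder pos) {A : Finset V} {x : V} (hx : x ∈ G.embV) (hxA : x ∈ A)
    (hlast : ∀ y ∈ A, y ∈ G.embV → pos y ≤ pos x) :
    G.outEdges pos x ⊆ G.outFlow pos A := by
  intro e he
  obtain ⟨he, hxe, h⟩ := G.mem_outEdges.1 he
  refine G.mem_outFlow.2 ⟨he, x, hxe, hxA, h.imp_right ?_⟩
  rintro ⟨y, hy, hxy⟩
  refine ⟨y, hy, fun hyA => ?_, hxy⟩
  by_cases hyE : y ∈ G.embV
  · exact absurd (hlast y hyA hyE) (not_le.2 hxy)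
  · exact absurd (hpos.2 y (G.mem_dataV.2 hyE) x hx) (not_lt.2 hxy.le)

theorem outFlow_univ (G : SketchedNetwork V E) (pos : V → ℕ) :
    G.outFlow pos Finset.univ ⊆ G.outputEdges := by
  intro e he
  simp only [mem_outFlow, Finset.mem_univ, not_true_eq_false, false_and, and_false,
    exists_false, or_false] at he
  obtain ⟨h1, -, -, -, h2⟩ := he
  exact Finset.mem_filter.2 ⟨h1, h2⟩

/-- Only output edges can leave the last embedding vertex of the whole network. -/
theorem scale_le_sketchSize (G : SketchedNetwork V E) {pos : V → ℕ} {s : ℝ}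
    (hpos : G.IsSketchOrder pos) (hs : ∀ x ∈ G.embV, s ≤ (G.effSketchDim pos x : ℝ))
    (hout : G.outputEdges.Nonempty) : s ≤ G.sketchSize := by
  obtain ⟨e, he⟩ := hout
  obtain ⟨z, -, hz⟩ := G.exists_end_embV (Finset.mem_filter.1 he).1
  obtain ⟨x, -, hx, hlast⟩ := G.exists_last pos (A := Finset.univ) ⟨z, Finset.mem_univ z, hz⟩
  refine (hs x hx).trans ?_
  rw [effSketchDim_eq_vol, sketchSize_eq_vol]
  exact G.vol_mono ((G.outEdges_subset_outFlow hpos hx (Finset.mem_univ x) hlast).trans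
    (G.outFlow_univ pos))

/-- If `A` contains embedding vertices, the last of them sends all its out-edges outside `A`. If `A`
is pure data, an edge to be sketched leaves `A`, and its size alone exceeds `m`. -/
theorem sketchSize_le_outFlow (G : SketchedNetwork V E) {pos : V → ℕ} {K : ℝ} (hK : 1 ≤ K)
    (hpos : G.IsSketchOrder pos)
    (heff : ∀ x ∈ G.embV, (G.sketchSize : ℝ) ≤ K * G.effSketchDim pos x)
    (hunif : G.UniformSketchDims) {A : Finset V} (hA : A.Nonempty) :
    (G.sketchSize : ℝ) ≤ K * G.vol (G.outFlow pos A) := by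
  by_cases h : ∃ x ∈ A, x ∈ G.embV
  · obtain ⟨x, hxA, hx, hlast⟩ := G.exists_last pos h
    refine (heff x hx).trans ?_
    rw [effSketchDim_eq_vol]
    gcongr
    exact G.vol_mono (G.outEdges_subset_outFlow hpos hx hxA hlast)
  · push Not at h
    obtain ⟨x, hx⟩ := hA
    have hxD := G.mem_dataV.2 (h x hx)
    obtain ⟨e, he, hxe⟩ := hunif.1 x hxD
    have heE := (Finset.mem_filter.1 he).1
    obtain ⟨z, hz, hzE⟩ := G.exists_end_embV heE
    have hmem : e ∈ G.outFlow pos A :=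
      G.mem_outFlow.2 ⟨heE, x, hxe, hx, Or.inr ⟨z, hz, fun h' => h z h' hzE, hpos.2 x hxD z hzE⟩⟩
    have h1 : (G.sketchSize : ℝ) ≤ G.dim e := by exact_mod_cast (hunif.2 e he).le
    have h2 := G.dim_le_vol hmem
    nlinarith [G.vol_pos (G.outFlow pos A)]

theorem outFlow_subset_boundary [Fintype E] (G : SketchedNetwork V E) (pos : V → ℕ)
    (A : Finset V) : G.outFlow pos A ⊆ G.boundary Finset.univ A := by
  intro e he
  obtain ⟨-, x, hx, hxA, h⟩ := G.mem_outFlow.1 he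
  refine G.mem_boundary.2 ⟨Finset.mem_univ e, ⟨x, hx, hxA⟩, h.imp_right ?_⟩
  rintro ⟨y, hy, hyA, -⟩
  exact ⟨y, hy, hyA⟩

/-- Data vertices precede embedding vertices, so an embedding edge at `x` has its tail at `x` and
cannot flow out of a set missing `x`. Hence the whole tensor at `x`, sketched edges included,
multiplies the outflow of its partner. -/
theorem boundary_singleton_disjoint_outFlow [Fintype E] (G : SketchedNetwork V E) {pos : V → ℕ}
    (hpos : G.IsSketchOrder pos) {x : V} (hx : x ∈ G.dataV) {B : Finset V} (hxB : x ∉ B) :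
    Disjoint (G.boundary Finset.univ {x}) (G.outFlow pos B) := by
  rw [Finset.disjoint_left]
  intro e h1 h2
  obtain ⟨-, ⟨x', hxe, hx'⟩, -⟩ := G.mem_boundary.1 h1
  obtain rfl := Finset.mem_singleton.1 hx'
  obtain ⟨he, y, hy, hyB, h⟩ := G.mem_outFlow.1 h2
  have hxy : x' ≠ y := by rintro rfl; exact hxB hyB
  obtain ⟨z, hz, hzB, hyz⟩ := h.resolve_left (G.notMem_uncontracted he hxe hy hxy)
  obtain ⟨w, hw, hwE⟩ := G.exists_end_embV he
  rcases G.eq_or_eq_of_mem_ends he hxe hy hxy hz with rfl | rfl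
  · rcases G.eq_or_eq_of_mem_ends he hxe hy hxy hw with rfl | rfl
    · exact G.mem_dataV.1 hx hwE
    · exact absurd (hpos.2 _ hx _ hwE) (not_lt.2 hyz.le)
  · exact hzB hyB

/-- The part of the cost of a contraction that is due to the data edges and to a set of embedding
edges in the boundaries of the two inputs. -/
theorem le_exp_logCost [Fintype E] (G : SketchedNetwork V E) {A B : Finset V} (h : Disjoint A B)
    {R F : Finset E} (hF : F ⊆ G.embE)
    (hR : R ⊆ G.boundary G.dataOnlyEdges A ∪ G.boundary G.dataOnlyEdges B)
    (hF' : F ⊆ G.boundary Finset.univ A ∪ G.boundary Finset.univ B) :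
    G.vol R * G.vol F ≤ Real.exp (G.logCost Finset.univ A B) := by
  rw [G.exp_logCost _ h]
  have hsub : ∀ A : Finset V, G.boundary G.dataOnlyEdges A ⊆ G.boundary Finset.univ A := by
    intro A e he
    obtain ⟨-, h⟩ := G.mem_boundary.1 he
    exact G.mem_boundary.2 ⟨Finset.mem_univ e, h⟩
  refine G.vol_mul_le ?_ (hR.trans (Finset.union_subset_union (hsub A) (hsub B))) hF'
  rw [Finset.disjoint_left]
  intro e he he'
  have hcompl : e ∈ G.dataOnlyEdges := by
    rcases Finset.mem_union.1 (hR he) with h | h <;> exact (G.mem_boundary.1 h).1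
  exact Finset.mem_compl.1 hcompl (hF he')

theorem outFlow_subset_embE (G : SketchedNetwork V E) (pos : V → ℕ) (A : Finset V) :
    G.outFlow pos A ⊆ G.embE := Finset.filter_subset _ _

theorem logCost_comm [Fintype E] (G : SketchedNetwork V E) (A B : Finset V) :
    G.logCost Finset.univ A B = G.logCost Finset.univ B A := by
  simp only [TensorNetwork.logCost, G.cutBetween_comm _ A B]
  ring

/-- A contraction costs at least the data part times the outflows of its two inputs. -/
theorem le_exp_logCost_of_outFlow [Fintype E] (G : SketchedNetwork V E) (pos : V → ℕ)
    {A B : Finset V} (h : Disjoint A B) {R : Finset E}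
    (hR : R ⊆ G.boundary G.dataOnlyEdges A ∪ G.boundary G.dataOnlyEdges B) :
    G.vol R * (G.vol (G.outFlow pos A) * G.vol (G.outFlow pos B)) ≤
      Real.exp (G.logCost Finset.univ A B) := by
  rw [← G.vol_union (G.outFlow_disjoint pos h)]
  exact G.le_exp_logCost h
    (Finset.union_subset (G.outFlow_subset_embE pos A) (G.outFlow_subset_embE pos B)) hR
    (Finset.union_subset_union (G.outFlow_subset_boundary pos A) (G.outFlow_subset_boundary pos B))

end SketchedNetwork

/-- Two costs whose product dominates the square of the second summand of the sketching cost. -/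
theorem sqrt_term_le {a b c d m K f q X Y : ℝ} (ha : 0 < a) (hb : 0 < b) (hc : 0 < c) (hd : 0 < d)
    (hm : 0 < m) (hK : 1 ≤ K) (hX : a * c * d * f * m ≤ K ^ 2 * X)
    (hY : a * b * d * q * m ^ 2 ≤ K ^ 2 * Y) (hf : 0 < f) (hq : 0 < q)
    (hfq : m ^ 2 ≤ K ^ 2 * (f * q)) :
    m ^ 2 * d * Real.sqrt (a * b * c * m) * min (Real.sqrt a) (Real.sqrt c) ≤ K ^ 3 * (X + Y) := by
  have hK0 : 0 < K := zero_lt_one.trans_le hK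
  have hX0 : 0 < X := by
    have : 0 < K ^ 2 * X := lt_of_lt_of_le (by positivity) hX
    exact pos_of_mul_pos_right this (by positivity)
  have hY0 : 0 < Y := by
    have : 0 < K ^ 2 * Y := lt_of_lt_of_le (by positivity) hY
    exact pos_of_mul_pos_right this (by positivity)
  -- Only `√a` is kept from the minimum; the bound with `√c` comes from applying the lemma with `a`
  -- and `c` exchanged.
  have h1 : m ^ 2 * d * Real.sqrt (a * b * c * m) * min (Real.sqrt a) (Real.sqrt c) ≤
      m ^ 2 * d * Real.sqrt (a * b * c * m) * Real.sqrt a := by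
    gcongr
    exact min_le_left _ _
  refine h1.trans ?_
  refine (pow_le_pow_iff_left₀ (by positivity) (by positivity) two_ne_zero).1 ?_
  calc (m ^ 2 * d * Real.sqrt (a * b * c * m) * Real.sqrt a) ^ 2
      = (m ^ 2 * d) ^ 2 * Real.sqrt (a * b * c * m) ^ 2 * Real.sqrt a ^ 2 := by ring
    _ = (a * c * d * m) * (a * b * d * m ^ 2) * m ^ 2 := by
        rw [Real.sq_sqrt (by positivity), Real.sq_sqrt ha.le]; ring
    _ ≤ (a * c * d * m) * (a * b * d * m ^ 2) * (K ^ 2 * (f * q)) := by gcongr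
    _ = K ^ 2 * ((a * c * d * f * m) * (a * b * d * q * m ^ 2)) := by ring
    _ ≤ K ^ 2 * ((K ^ 2 * X) * (K ^ 2 * Y)) := by gcongr
    _ = (K ^ 3) ^ 2 * (X * Y) := by ring
    _ ≤ (K ^ 3) ^ 2 * (X + Y) ^ 2 := by gcongr; nlinarith
    _ = (K ^ 3 * (X + Y)) ^ 2 := by ring

/-! ### Charging costs to data vertex sets -/

namespace SketchedNetwork

variable {V : Type u} {E : Type v} [Fintype V] [DecidableEq V] [Fintype E] [DecidableEq E]

/-- The data vertex sets of the two inputs and of the output of a contraction. -/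
def dataNodes (G : SketchedNetwork V E) (p : Finset V × Finset V) : Finset (Finset V) :=
  {p.1 ∩ G.dataV, p.2 ∩ G.dataV, (p.1 ∪ p.2) ∩ G.dataV}

/-- The total cost of the contractions of `T` one of whose inputs, or whose output, has the data
vertex set `S`. -/
noncomputable def chargedCost (G : SketchedNetwork V E) (T : ContractionTree V) (S : Finset V) : ℝ :=
  ∑ p ∈ T.contractions.toFinset,
    if S ∈ G.dataNodes p then Real.exp (G.logCost Finset.univ p.1 p.2) else 0

theorem cost_eq_sum (G : SketchedNetwork V E) {T : ContractionTree V} (hT : T.leaves.Nodup) :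
    T.cost G.toTensorNetwork =
      ∑ p ∈ T.contractions.toFinset, Real.exp (G.logCost Finset.univ p.1 p.2) :=
  (List.sum_toFinset _ (ContractionTree.nodup_contractions hT)).symm

/-- After exchanging the sums, each contraction is counted once per element of `dataNodes`, which
has at most three. -/
theorem sum_chargedCost_le (G : SketchedNetwork V E) {T : ContractionTree V}
    (hT : T.leaves.Nodup) (S : Finset (Finset V)) :
    ∑ s ∈ S, G.chargedCost T s ≤ 3 * T.cost G.toTensorNetwork := by
  rw [G.cost_eq_sum hT, Finset.mul_sum]
  simp only [chargedCost]
  rw [Finset.sum_comm]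
  refine Finset.sum_le_sum fun p _ => ?_
  rw [← Finset.sum_filter, Finset.sum_const, nsmul_eq_mul]
  have h1 : (S.filter fun s => s ∈ G.dataNodes p).card ≤ 3 :=
    (Finset.card_le_card fun s hs => (Finset.mem_filter.1 hs).2).trans Finset.card_le_three
  gcongr
  exact_mod_cast h1

theorem exp_logCost_le_chargedCost (G : SketchedNetwork V E) {T : ContractionTree V}
    {p : Finset V × Finset V} (hp : p ∈ T.contractions) {S : Finset V} (hS : S ∈ G.dataNodes p) :
    Real.exp (G.logCost Finset.univ p.1 p.2) ≤ G.chargedCost T S := by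
  have := Finset.single_le_sum (s := T.contractions.toFinset) (f := fun p =>
    if S ∈ G.dataNodes p then Real.exp (G.logCost Finset.univ p.1 p.2) else 0)
    (fun q _ => by split_ifs <;> positivity) (List.mem_toFinset.2 hp)
  simpa [hS, chargedCost] using this

theorem chargedCost_nonneg (G : SketchedNetwork V E) (T : ContractionTree V) (S : Finset V) :
    0 ≤ G.chargedCost T S :=
  Finset.sum_nonneg fun q _ => by split_ifs <;> positivity

theorem sum_image_chargedCost_le (G : SketchedNetwork V E) {T : ContractionTree V}
    (hT : T.leaves.Nodup) {ι : Type*} (I : Finset ι) (f : ι → Finset V)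
    (hf : Set.InjOn f I) :
    ∑ i ∈ I, G.chargedCost T (f i) ≤ 3 * T.cost G.toTensorNetwork := by
  rw [← Finset.sum_image hf]
  exact G.sum_chargedCost_le hT _

/-- The contraction consuming the leaf `x` pays for the full tensor at `x` and, disjointly, for the
outflow of the other input. -/
theorem leaf_term_le (G : SketchedNetwork V E) {pos : V → ℕ} {K : ℝ} (hK : 1 ≤ K)
    (hpos : G.IsSketchOrder pos)
    (hflow : ∀ A : Finset V, A.Nonempty → (G.sketchSize : ℝ) ≤ K * G.vol (G.outFlow pos A))
    {T : ContractionTree V} (hT : T.IsTreeOf Finset.univ) (hE : G.embV.Nonempty)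
    {x : V} (hx : x ∈ G.dataV) :
    Real.exp (G.cut Finset.univ {x}) * G.sketchSize ≤ K * G.chargedCost T {x} := by
  have hne : ({x} : Finset V) ≠ T.verts := by
    rw [hT.2]
    intro h
    obtain ⟨y, hy⟩ := hE
    have hy' := Finset.mem_univ y
    rw [← h, Finset.mem_singleton] at hy'
    exact G.mem_dataV.1 hx (hy' ▸ hy)
  have hxT : x ∈ T.verts := by rw [hT.2]; exact Finset.mem_univ x
  have hxD : ({x} : Finset V) ∩ G.dataV = {x} := by simpa using hx
  have key : ∀ B : Finset V, B.Nonempty → Disjoint {x} B →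
      Real.exp (G.cut Finset.univ {x}) * G.sketchSize ≤
        K * Real.exp (G.logCost Finset.univ {x} B) := by
    intro B hB hd
    rw [G.exp_cut, G.exp_logCost _ hd]
    have h1 := G.vol_mul_le (G.boundary_singleton_disjoint_outFlow hpos hx
      (Finset.disjoint_singleton_left.1 hd)) Finset.subset_union_left
      ((G.outFlow_subset_boundary pos B).trans
        (Finset.subset_union_right (s₁ := G.boundary Finset.univ {x})))
    calc _ ≤ G.vol (G.boundary Finset.univ {x}) * (K * G.vol (G.outFlow pos B)) := by
          have := G.vol_pos (G.boundary Finset.univ {x})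
          gcongr
          exact hflow B hB
      _ = K * (G.vol (G.boundary Finset.univ {x}) * G.vol (G.outFlow pos B)) := by ring
      _ ≤ _ := by gcongr
  obtain ⟨p, hp, h⟩ := ContractionTree.exists_parent (Or.inl ⟨x, hxT, rfl⟩) hne
  obtain ⟨h1, h2, hd, -, -⟩ := ContractionTree.contraction_spec hT.1 hp
  have hmem : ({x} : Finset V) ∈ G.dataNodes p := by
    rcases h with h | h <;> simp [dataNodes, h, hxD]
  have hch := G.exp_logCost_le_chargedCost hp hmem
  refine le_trans ?_ (mul_le_mul_of_nonneg_left hch (zero_le_one.trans hK))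
  rcases h with h | h
  · rw [h] at hd ⊢
    exact key _ h2 hd
  · rw [h] at hd ⊢
    rw [G.logCost_comm]
    exact key _ h1 hd.symm

/-- If the last embedding vertex of `A ∪ B` is in `A`, then forming `A` is expensive unless the
flow out of `A ∪ B` is large. -/
theorem exists_forming_cost (G : SketchedNetwork V E) {pos : V → ℕ} {K : ℝ} (hK : 1 ≤ K)
    (hpos : G.IsSketchOrder pos)
    (heff : ∀ x ∈ G.embV, (G.sketchSize : ℝ) ≤ K * G.effSketchDim pos x)
    (hflow : ∀ A : Finset V, A.Nonempty → (G.sketchSize : ℝ) ≤ K * G.vol (G.outFlow pos A))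
    {X Y A B : Finset V} (hXY : Disjoint X Y) (hX : X.Nonempty) (hY : Y.Nonempty)
    (hA : A = X ∪ Y) (hAB : Disjoint A B) (hB : B.Nonempty) {x : V} (hxA : x ∈ A)
    (hx : x ∈ G.embV) (hlast : ∀ y ∈ A ∪ B, y ∈ G.embV → pos y ≤ pos x) :
    ∃ q : ℝ, 0 < q ∧
      (G.sketchSize : ℝ) ^ 2 ≤ K ^ 2 * (G.vol (G.outFlow pos (A ∪ B)) * q) ∧
      Real.exp (G.cut G.dataOnlyEdges (A ∩ G.dataV)) * q * (G.sketchSize : ℝ) ^ 2 ≤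
        K ^ 2 * Real.exp (G.logCost Finset.univ X Y) := by
  have hm := G.sketchSize_pos
  set m : ℝ := (G.sketchSize : ℝ)
  -- `Q` is the set of edges flowing from `B` into `A`; its size is the witness `q`.
  set Q : Finset E := G.outFlow pos B \ G.outFlow pos (A ∪ B) with hQ
  have hvX := hflow X hX
  have hvY := hflow Y hY
  have hvB := hflow B hB
  have hvx := heff x hx
  rw [G.effSketchDim_eq_vol] at hvx
  refine ⟨G.vol Q, G.vol_pos Q, ?_, ?_⟩
  -- The edges out of `x` all leave `A ∪ B`, since `x` is last there. The outflow of `B` either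
  -- leaves `A ∪ B` or is in `Q`. The two sets are disjoint and each has size at least `m / K`.
  · have hdis : Disjoint (G.outEdges pos x) (G.outFlow pos B) :=
      Finset.disjoint_of_subset_left (G.outEdges_subset_outFlow hpos hx hxA
        fun y hy => hlast y (Finset.mem_union_left _ hy)) (G.outFlow_disjoint pos hAB)
    have h1 : G.vol (G.outEdges pos x ∪ G.outFlow pos B) ≤
        G.vol (G.outFlow pos (A ∪ B)) * G.vol Q := by
      rw [← G.vol_union Finset.disjoint_sdiff]
      apply G.vol_mono
      intro e he
      rcases Finset.mem_union.1 he with he | he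
      · exact Finset.mem_union_left _
          (G.outEdges_subset_outFlow hpos hx (Finset.mem_union_left _ hxA) hlast he)
      · simp only [Finset.mem_union, Finset.mem_sdiff]
        tauto
    rw [G.vol_union hdis] at h1
    calc m ^ 2 = m * m := sq m
      _ ≤ (K * G.vol (G.outEdges pos x)) * (K * G.vol (G.outFlow pos B)) := by
          gcongr
          exact hm.le.trans hvx
      _ = K ^ 2 * (G.vol (G.outEdges pos x) * G.vol (G.outFlow pos B)) := by ring
      _ ≤ _ := by gcongr
  · have hXB : Disjoint X B := Finset.disjoint_of_subset_left
      (hA ▸ Finset.subset_union_left) hAB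
    have hYB : Disjoint Y B := Finset.disjoint_of_subset_left
      (hA ▸ Finset.subset_union_right) hAB
    have hdX := G.outFlow_disjoint pos hXB
    have hdY := G.outFlow_disjoint pos hYB
    have hQB : Q ⊆ G.outFlow pos B := Finset.sdiff_subset
    have hdis : Disjoint (G.outFlow pos X ∪ G.outFlow pos Y) Q :=
      Finset.disjoint_of_subset_right hQB (Finset.disjoint_union_left.2 ⟨hdX, hdY⟩)
    -- The head of an edge of `Q` is in `A = X ∪ Y` and its tail is in `B`, so it is still open when
    -- `X` and `Y` are contracted, and is paid for on top of their outflows.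
    have hQbd : Q ⊆ G.boundary Finset.univ X ∪ G.boundary Finset.univ Y := by
      intro e he
      obtain ⟨heB, heW⟩ := Finset.mem_sdiff.1 he
      obtain ⟨heE, y, hye, hyB, h⟩ := G.mem_outFlow.1 heB
      have hu : e ∉ G.uncontracted := fun hu =>
        heW (G.mem_outFlow.2 ⟨heE, y, hye, Finset.mem_union_right _ hyB, Or.inl hu⟩)
      obtain ⟨z, hze, hzB, hyz⟩ := h.resolve_left hu
      have hzA : z ∈ A := by
        by_contra hzA
        exact heW (G.mem_outFlow.2 ⟨heE, y, hye, Finset.mem_union_right _ hyB,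
          Or.inr ⟨z, hze, by simp [hzA, hzB], hyz⟩⟩)
      rw [hA] at hzA
      rcases Finset.mem_union.1 hzA with hz | hz
      · exact Finset.mem_union_left _ (G.mem_boundary.2 ⟨Finset.mem_univ e, ⟨z, hze, hz⟩,
          Or.inr ⟨y, hye, Finset.disjoint_right.1 hXB hyB⟩⟩)
      · exact Finset.mem_union_right _ (G.mem_boundary.2 ⟨Finset.mem_univ e, ⟨z, hze, hz⟩,
          Or.inr ⟨y, hye, Finset.disjoint_right.1 hYB hyB⟩⟩)
    have h1 := G.le_exp_logCost hXY
      (R := G.boundary G.dataOnlyEdges A) (F := G.outFlow pos X ∪ G.outFlow pos Y ∪ Q)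
      (Finset.union_subset (Finset.union_subset (G.outFlow_subset_embE pos X)
        (G.outFlow_subset_embE pos Y)) (hQB.trans (G.outFlow_subset_embE pos B)))
      (hA ▸ G.boundary_union_subset _ X Y)
      (Finset.union_subset (Finset.union_subset_union (G.outFlow_subset_boundary pos X)
        (G.outFlow_subset_boundary pos Y)) hQbd)
    rw [G.vol_union hdis, G.vol_union (G.outFlow_disjoint pos hXY)] at h1
    rw [G.exp_cut, G.boundary_inter_dataV]
    have p1 := G.vol_pos (G.boundary G.dataOnlyEdges A)
    have p2 := G.vol_pos Q
    calc G.vol (G.boundary G.dataOnlyEdges A) * G.vol Q * m ^ 2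
        = G.vol (G.boundary G.dataOnlyEdges A) * G.vol Q * (m * m) := by ring
      _ ≤ G.vol (G.boundary G.dataOnlyEdges A) * G.vol Q *
          ((K * G.vol (G.outFlow pos X)) * (K * G.vol (G.outFlow pos Y))) := by
          gcongr
          exact hm.le.trans hvX
      _ = K ^ 2 * (G.vol (G.boundary G.dataOnlyEdges A) *
          (G.vol (G.outFlow pos X) * G.vol (G.outFlow pos Y) * G.vol Q)) := by ring
      _ ≤ _ := by gcongr

/-! ### The sizes `a`, `b`, `c`, `d` as factors of data cuts and data costs -/

theorem sizeLeft_pos (G : SketchedNetwork V E) (A B : Finset V) : 0 < G.sizeLeft A B :=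
  Real.exp_pos _

theorem sizeShared_pos (G : SketchedNetwork V E) (A B : Finset V) : 0 < G.sizeShared A B :=
  div_pos (Real.exp_pos _) (mul_pos (G.sizeLeft_pos _ _) (G.sizeLeft_pos _ _))

theorem sizeContracted_pos (G : SketchedNetwork V E) (A B : Finset V) :
    0 < G.sizeContracted A B :=
  div_pos (Real.exp_pos _) (G.sizeShared_pos _ _)

theorem sizeShared_comm (G : SketchedNetwork V E) (A B : Finset V) :
    G.sizeShared A B = G.sizeShared B A := by
  rw [sizeShared, sizeShared, Finset.union_comm, mul_comm]

theorem sizeContracted_comm (G : SketchedNetwork V E) (A B : Finset V) :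
    G.sizeContracted A B = G.sizeContracted B A := by
  rw [sizeContracted, sizeContracted, sizeShared_comm, G.cutBetween_comm]

theorem sketchTerm_comm (G : SketchedNetwork V E) (A B : Finset V) :
    G.sketchTerm A B = G.sketchTerm B A := by
  simp only [sketchTerm]
  rw [G.sizeShared_comm A B, G.sizeContracted_comm A B, min_comm]
  ring_nf

theorem exp_cut_union (G : SketchedNetwork V E) (A B : Finset V) :
    Real.exp (G.cut G.dataOnlyEdges (A ∪ B)) =
      G.sizeLeft A B * G.sizeLeft B A * G.sizeShared A B := by
  have h1 := (G.sizeLeft_pos A B).ne'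
  have h2 := (G.sizeLeft_pos B A).ne'
  rw [sizeShared]
  field_simp

theorem exp_cut_eq (G : SketchedNetwork V E) (A B : Finset V) :
    Real.exp (G.cut G.dataOnlyEdges A) =
      G.sizeLeft A B * G.sizeContracted A B * G.sizeShared A B := by
  have h1 := (G.sizeShared_pos A B).ne'
  rw [sizeContracted, mul_assoc, div_mul_cancel₀ _ h1, sizeLeft, ← Real.exp_add]
  congr 1
  ring

theorem exp_logCost_data (G : SketchedNetwork V E) (A B : Finset V) :
    Real.exp (G.logCost G.dataOnlyEdges A B) =
      G.sizeLeft A B * G.sizeContracted A B * G.sizeLeft B A * G.sizeShared A B := by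
  have h : Real.exp (G.logCost G.dataOnlyEdges A B) =
      Real.exp (G.cut G.dataOnlyEdges A) * G.sizeLeft B A := by
    rw [sizeLeft, ← Real.exp_add, TensorNetwork.logCost, G.cutBetween_comm _ B A]
    congr 1
    ring
  rw [h, G.exp_cut_eq A B]
  ring

theorem one_le_sizeLeft (G : SketchedNetwork V E) {A B : Finset V} (h : Disjoint A B) :
    1 ≤ G.sizeLeft A B :=
  Real.one_le_exp (sub_nonneg.2 (G.cutBetween_le_cut _ h))

/-- Up to three contractions pay: `(A, B)` itself, the one consuming `A ∪ B`, and the one forming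
the input that contains the last embedding vertex. The first two are both charged to the data set of
`A ∪ B`. The coefficient 3 is one share for the first summand and at most two for the second. -/
theorem sketchTerm_le (G : SketchedNetwork V E) {pos : V → ℕ} {K : ℝ} (hK : 1 ≤ K)
    (hpos : G.IsSketchOrder pos)
    (heff : ∀ x ∈ G.embV, (G.sketchSize : ℝ) ≤ K * G.effSketchDim pos x)
    (hflow : ∀ A : Finset V, A.Nonempty → (G.sketchSize : ℝ) ≤ K * G.vol (G.outFlow pos A))
    {T : ContractionTree V} (hT : T.IsTreeOf Finset.univ) {A B : Finset V}
    (hp : (A, B) ∈ T.contractions) (hU : (A ∩ G.dataV).Nonempty) (hV : (B ∩ G.dataV).Nonempty) :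
    G.sketchTerm (A ∩ G.dataV) (B ∩ G.dataV) ≤
      K ^ 3 * (3 * G.chargedCost T (A ∩ G.dataV ∪ B ∩ G.dataV) +
        G.chargedCost T (A ∩ G.dataV) + G.chargedCost T (B ∩ G.dataV)) := by
  obtain ⟨hA, hB, hAB, -, -⟩ := ContractionTree.contraction_spec hT.1 hp
  simp only at hA hB hAB
  have hUV : Disjoint (A ∩ G.dataV) (B ∩ G.dataV) :=
    Finset.disjoint_of_subset_left Finset.inter_subset_left
      (Finset.disjoint_of_subset_right Finset.inter_subset_left hAB)
  have hW : (A ∪ B) ∩ G.dataV = A ∩ G.dataV ∪ B ∩ G.dataV := Finset.union_inter_distrib_right _ _ _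
  have nU := G.chargedCost_nonneg T (A ∩ G.dataV)
  have nV := G.chargedCost_nonneg T (B ∩ G.dataV)
  have eU := G.exp_cut_eq (A ∩ G.dataV) (B ∩ G.dataV)
  have eV := G.exp_cut_eq (B ∩ G.dataV) (A ∩ G.dataV)
  have eUV := G.exp_cut_union (A ∩ G.dataV) (B ∩ G.dataV)
  have eL := G.exp_logCost_data (A ∩ G.dataV) (B ∩ G.dataV)
  rw [G.sizeShared_comm (B ∩ G.dataV), G.sizeContracted_comm (B ∩ G.dataV)] at eV
  have hc1 := G.one_le_sizeLeft hUV.symm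
  have ha0 := G.sizeLeft_pos (A ∩ G.dataV) (B ∩ G.dataV)
  have hc0 := G.sizeLeft_pos (B ∩ G.dataV) (A ∩ G.dataV)
  have hb0 := G.sizeContracted_pos (A ∩ G.dataV) (B ∩ G.dataV)
  have hd0 := G.sizeShared_pos (A ∩ G.dataV) (B ∩ G.dataV)
  have hm := G.sketchSize_pos
  simp only [sketchTerm]
  set a := G.sizeLeft (A ∩ G.dataV) (B ∩ G.dataV)
  set c := G.sizeLeft (B ∩ G.dataV) (A ∩ G.dataV)
  set b := G.sizeContracted (A ∩ G.dataV) (B ∩ G.dataV)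
  set d := G.sizeShared (A ∩ G.dataV) (B ∩ G.dataV)
  set m : ℝ := (G.sketchSize : ℝ)
  set U := A ∩ G.dataV with hUdef
  set V' := B ∩ G.dataV with hVdef
  set N := G.chargedCost T (U ∪ V')
  have hbW : G.vol (G.boundary G.dataOnlyEdges (A ∪ B)) = a * c * d := by
    rw [← eUV, G.exp_cut, ← hW, G.boundary_inter_dataV]
  have hbL : G.vol (G.boundary G.dataOnlyEdges A ∪ G.boundary G.dataOnlyEdges B) =
      a * b * c * d := by
    rw [← eL, G.exp_logCost _ hUV, hUdef, hVdef, G.boundary_inter_dataV, G.boundary_inter_dataV]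
  have hacd : a * c * d ≤ a * b * c * d := by
    rw [← hbW, ← hbL]
    exact G.vol_mono (G.boundary_union_subset _ A B)
  set fA := G.vol (G.outFlow pos A)
  set fB := G.vol (G.outFlow pos B)
  have hfA : m ≤ K * fA := hflow A hA
  have hfB : m ≤ K * fB := hflow B hB
  have hfApos : 0 < fA := G.vol_pos _
  have hfBpos : 0 < fB := G.vol_pos _
  have hm2 : m ^ 2 ≤ K ^ 2 * (fA * fB) := by
    calc m ^ 2 = m * m := sq m
      _ ≤ (K * fA) * (K * fB) := by gcongr
      _ = _ := by ring
  have hcost : a * b * c * d * (fA * fB) ≤ N := by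
    have h1 := G.le_exp_logCost_of_outFlow pos hAB subset_rfl
    rw [hbL] at h1
    exact h1.trans (G.exp_logCost_le_chargedCost hp (by simp [dataNodes, hW]))
  have hX1 : a * b * c * d * m ^ 2 ≤ K ^ 2 * N := by
    calc a * b * c * d * m ^ 2 ≤ a * b * c * d * (K ^ 2 * (fA * fB)) := by gcongr
      _ = K ^ 2 * (a * b * c * d * (fA * fB)) := by ring
      _ ≤ _ := by gcongr
  have hN0 : 0 ≤ N := G.chargedCost_nonneg T _
  have hfirst : a * b * c * d * m ^ 2 ≤ K ^ 3 * N := by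
    refine hX1.trans ?_
    gcongr
    norm_num
  set f := G.vol (G.outFlow pos (A ∪ B)) with hf
  have hf0 : 0 < f := G.vol_pos _
  -- The cost of consuming `A ∪ B`. At the root nothing consumes it, but then `f ≤ m` and `(A, B)`
  -- itself suffices, as `acd ≤ abcd`.
  have hX2 : a * c * d * f * m ≤ K ^ 2 * N := by
    by_cases huniv : A ∪ B = T.verts
    · have hfm : f ≤ m := by
        rw [hf, huniv, hT.2]
        have := G.vol_mono (G.outFlow_univ pos)
        rwa [← G.sketchSize_eq_vol] at this
      calc a * c * d * f * m ≤ a * b * c * d * m * m := by gcongr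
        _ = a * b * c * d * m ^ 2 := by ring
        _ ≤ _ := hX1
    · have key : ∀ B' : Finset V, B'.Nonempty → Disjoint (A ∪ B) B' →
          a * c * d * f * m ≤ K * Real.exp (G.logCost Finset.univ (A ∪ B) B') := by
        intro B' hB' hdis
        have h1 := G.le_exp_logCost_of_outFlow pos hdis
          (R := G.boundary G.dataOnlyEdges (A ∪ B)) Finset.subset_union_left
        rw [hbW] at h1
        calc a * c * d * f * m ≤ a * c * d * f * (K * G.vol (G.outFlow pos B')) := by
              gcongr
              exact hflow B' hB'
          _ = K * (a * c * d * (f * G.vol (G.outFlow pos B'))) := by ring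
          _ ≤ _ := by gcongr
      obtain ⟨p, hp', h⟩ := ContractionTree.exists_parent (Or.inr ⟨_, hp, rfl⟩) huniv
      simp only at h
      obtain ⟨h1, h2, hd, -, -⟩ := ContractionTree.contraction_spec hT.1 hp'
      have hmem : U ∪ V' ∈ G.dataNodes p := by
        rcases h with h | h <;> simp [dataNodes, h, hW]
      have hch : K * Real.exp (G.logCost Finset.univ p.1 p.2) ≤ K ^ 2 * N := by
        have := G.exp_logCost_le_chargedCost hp' hmem
        gcongr
        nlinarith
      refine le_trans ?_ hch
      rcases h with h | h
      · rw [h] at hd ⊢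
        exact key _ h2 hd
      · rw [h] at hd ⊢
        rw [G.logCost_comm]
        exact key _ h1 hd.symm
  have hK3 : 0 ≤ K ^ 3 := by positivity
  -- Stated for `S` in either position, since the last embedding vertex may be in `A` or in `B`.
  -- Such an `S` contains both a data and an embedding vertex, so it is not a leaf and some
  -- contraction forms it.
  have hforming : ∀ S S' : Finset V, (S ∩ G.dataV).Nonempty →
      ((S, S') = (A, B) ∨ (S', S) = (A, B)) → ∀ x ∈ S, x ∈ G.embV →
      (∀ y ∈ S ∪ S', y ∈ G.embV → pos y ≤ pos x) →
      ∃ q : ℝ, 0 < q ∧ m ^ 2 ≤ K ^ 2 * (G.vol (G.outFlow pos (S ∪ S')) * q) ∧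
        Real.exp (G.cut G.dataOnlyEdges (S ∩ G.dataV)) * q * m ^ 2 ≤
          K ^ 2 * G.chargedCost T (S ∩ G.dataV) := by
    intro S S' hS hSS x hxS hxE hlast
    have hdis : Disjoint S S' ∧ S'.Nonempty ∧ ((A, B).1 = S ∨ (A, B).2 = S) := by
      rcases hSS with h | h <;> obtain ⟨rfl, rfl⟩ := Prod.mk.inj h
      · exact ⟨hAB, hB, Or.inl rfl⟩
      · exact ⟨hAB.symm, hA, Or.inr rfl⟩
    obtain ⟨hdis, hS', hch⟩ := hdis
    rcases ContractionTree.child_eq_singleton_or_union hp hch with ⟨y, hy⟩ | ⟨p, hp', hSp⟩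
    · obtain ⟨z, hz⟩ := hS
      obtain ⟨hz1, hz2⟩ := Finset.mem_inter.1 hz
      rw [hy, Finset.mem_singleton] at hz1 hxS
      exact absurd hxE (G.mem_dataV.1 (by rw [hxS, ← hz1]; exact hz2))
    · obtain ⟨h1, h2, hd, -, -⟩ := ContractionTree.contraction_spec hT.1 hp'
      obtain ⟨q, hq, h3, h4⟩ := G.exists_forming_cost hK hpos heff hflow hd h1 h2 hSp hdis hS'
        hxS hxE hlast
      refine ⟨q, hq, h3, h4.trans ?_⟩
      gcongr
      exact G.exp_logCost_le_chargedCost hp' (by simp [dataNodes, hSp])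
  have hsecond : m ^ 2 * d * Real.sqrt (a * b * c * m) * min (Real.sqrt a) (Real.sqrt c) ≤
      K ^ 3 * (2 * N + G.chargedCost T U + G.chargedCost T V') := by
    by_cases hex : ∃ x ∈ A ∪ B, x ∈ G.embV
    · obtain ⟨x, hx, hxE, hlast⟩ := G.exists_last pos hex
      rcases Finset.mem_union.1 hx with hxA | hxB
      · obtain ⟨q, hq, h3, h4⟩ := hforming A B hU (Or.inl rfl) x hxA hxE hlast
        rw [← hUdef, eU] at h4
        exact (sqrt_term_le ha0 hb0 hc0 hd0 hm hK hX2 h4 hf0 hq h3).trans <|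
          mul_le_mul_of_nonneg_left (by linarith) hK3
      · obtain ⟨q, hq, h3, h4⟩ := hforming B A hV (Or.inr rfl) x hxB hxE
          (by rwa [Finset.union_comm])
        rw [← hVdef, eV] at h4
        rw [Finset.union_comm B A] at h3
        have := sqrt_term_le hc0 hb0 ha0 hd0 hm hK (by linarith [hX2] :
          c * a * d * f * m ≤ K ^ 2 * N) h4 hf0 hq h3
        rw [min_comm, show c * b * a * m = a * b * c * m by ring] at this
        exact this.trans <| mul_le_mul_of_nonneg_left (by linarith) hK3
    · push Not at hex
      -- Without embedding vertices in `A ∪ B`, no embedding edge flows between `A` and `B`, so both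
      -- outflows leave the union and `f ≥ m² / K²`. Then `q = 1` works, and `(A, B)` itself
      -- replaces the forming contraction, using `c ≥ 1`.
      have hsub : fA * fB ≤ f := by
        have hS : ∀ S ⊆ A ∪ B, G.outFlow pos S ⊆ G.outFlow pos (A ∪ B) := by
          intro S hS e he
          obtain ⟨heE, y, hye, hyS, h⟩ := G.mem_outFlow.1 he
          obtain ⟨z, hz, hzE⟩ := G.exists_end_embV heE
          have hy := hex y (hS hyS)
          exact G.mem_outFlow.2 ⟨heE, y, hye, hS hyS,
            Or.inr ⟨z, hz, fun h' => hex z h' hzE, hpos.2 y (G.mem_dataV.2 hy) z hzE⟩⟩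
        exact G.vol_mul_le (G.outFlow_disjoint pos hAB) (hS A Finset.subset_union_left)
          (hS B Finset.subset_union_right)
      have h3 : m ^ 2 ≤ K ^ 2 * (f * 1) := hm2.trans (by rw [mul_one]; gcongr)
      have h4 : a * b * d * 1 * m ^ 2 ≤ K ^ 2 * N := by
        refine le_trans ?_ hX1
        have : a * b * d * 1 ≤ a * b * d * c := by gcongr
        calc a * b * d * 1 * m ^ 2 ≤ a * b * d * c * m ^ 2 := by gcongr
          _ = a * b * c * d * m ^ 2 := by ring
      refine (sqrt_term_le ha0 hb0 hc0 hd0 hm hK hX2 h4 hf0 one_pos h3).trans ?_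
      exact mul_le_mul_of_nonneg_left (by linarith) hK3
  linarith

end SketchedNetwork

/-! ### Summing the charges -/

theorem theoremE1 (c C : ℝ) (hc : 0 < c) (hC : 0 < C) :
    ∃ κ : ℝ, 0 < κ ∧
      ∀ (V : Type u) (E : Type v) [Fintype V] [DecidableEq V] [Fintype E] [DecidableEq E]
        (G : SketchedNetwork V E) (ε δ : ℝ) (T₀ T : ContractionTree V),
        0 < ε → 0 < δ → δ < 1 →
        G.UniformSketchDims →
        G.SufficientCondition c ε δ →
        G.outputEdges.card = 1 →
        (G.sketchSize : ℝ) ≤ C * G.accuracyScale ε δ →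
        T₀.IsTreeOf G.dataV →
        T.IsTreeOf Finset.univ →
        T.ConstrainedOn T₀ G.dataV →
        c * G.accuracyScale ε δ ≤ (G.sketchSize : ℝ) ∧
        κ * ((∑ x ∈ G.dataV, Real.exp (G.cut Finset.univ {x}) * (G.sketchSize : ℝ))
            + (T₀.contractions.map fun p => G.sketchTerm p.1 p.2).sum)
          ≤ T.cost G.toTensorNetwork := by
  -- `K` compares `m` with the effective sketch dimensions: `m ≤ C · scale ≤ K · c · scale`, where
  -- `c · scale` bounds each of those dimensions from below.
  obtain ⟨K, hK, hKc⟩ : ∃ K : ℝ, 1 ≤ K ∧ C ≤ K * c :=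
    ⟨max 1 (C / c), le_max_left _ _, (div_le_iff₀ hc).1 (le_max_right _ _)⟩
  have hK0 : 0 < K := zero_lt_one.trans_le hK
  -- 18 = 3 + 15: the leaves cost at most `3 K³ P` and the contractions of `T₀` at most `15 K³ P`.
  refine ⟨1 / (18 * K ^ 3), by positivity, ?_⟩
  intro V E _ _ _ _ G ε δ T₀ T hε hδ hδ1 hunif hsuff hout hmC hT₀ hT hcon
  obtain ⟨pos, hpos, hs⟩ := hsuff
  have hne : G.outputEdges.Nonempty := Finset.card_pos.1 (by omega)
  refine ⟨G.scale_le_sketchSize hpos hs hne, ?_⟩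
  have hscale : 0 < G.accuracyScale ε δ :=
    pos_of_mul_pos_right (G.sketchSize_pos.trans_le hmC) hC.le
  have heff : ∀ x ∈ G.embV, (G.sketchSize : ℝ) ≤ K * G.effSketchDim pos x := by
    intro x hx
    calc (G.sketchSize : ℝ) ≤ C * G.accuracyScale ε δ := hmC
      _ ≤ K * c * G.accuracyScale ε δ := by gcongr
      _ = K * (c * G.accuracyScale ε δ) := by ring
      _ ≤ _ := by gcongr; exact hs x hx
  have hflow : ∀ A : Finset V, A.Nonempty →
      (G.sketchSize : ℝ) ≤ K * G.vol (G.outFlow pos A) :=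
    fun A hA => G.sketchSize_le_outFlow hK hpos heff hunif hA
  have hembV : G.embV.Nonempty := by
    obtain ⟨e, he⟩ := hne
    obtain ⟨z, -, hz⟩ := G.exists_end_embV (Finset.mem_filter.1 he).1
    exact ⟨z, hz⟩
  set P := T.cost G.toTensorNetwork with hP
  have hP0 : 0 ≤ P := by
    rw [hP, G.cost_eq_sum hT.1]
    positivity
  have hleaves : ∑ x ∈ G.dataV, Real.exp (G.cut Finset.univ {x}) * (G.sketchSize : ℝ) ≤
      K ^ 3 * (3 * P) := by
    calc _ ≤ ∑ x ∈ G.dataV, K * G.chargedCost T {x} :=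
          Finset.sum_le_sum fun x hx => G.leaf_term_le hK hpos hflow hT hembV hx
      _ = K * ∑ x ∈ G.dataV, G.chargedCost T {x} := by rw [Finset.mul_sum]
      _ ≤ K * (3 * P) := by
          gcongr
          exact G.sum_image_chargedCost_le hT.1 _ _ (Finset.singleton_injective.injOn)
      _ ≤ K ^ 3 * (3 * P) := by
          gcongr
          exact le_self_pow₀ hK (by norm_num)
  have hterm : ∀ p ∈ T₀.contractions, G.sketchTerm p.1 p.2 ≤
      K ^ 3 * (3 * G.chargedCost T (p.1 ∪ p.2) + G.chargedCost T p.1 + G.chargedCost T p.2) := by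
    rintro ⟨U, W⟩ hp
    obtain ⟨hU, hW, -, -, -⟩ := ContractionTree.contraction_spec hT₀.1 hp
    obtain ⟨A, B, h, rfl, rfl⟩ := hcon U W (Or.inl hp)
    rcases h with h | h
    · exact G.sketchTerm_le hK hpos heff hflow hT h hU hW
    · have := G.sketchTerm_le hK hpos heff hflow hT h hW hU
      rw [G.sketchTerm_comm, Finset.union_comm] at this
      dsimp only
      linarith
  have hinj : ∀ f : Finset V × Finset V → Finset V, Set.InjOn f {p | p ∈ T₀.contractions} →
      ∑ p ∈ T₀.contractions.toFinset, G.chargedCost T (f p) ≤ 3 * P := fun f hf =>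
    G.sum_image_chargedCost_le hT.1 _ _ (by simpa [List.coe_toFinset] using hf)
  -- 15 = 3 · 3 + 3 + 3: outputs, first inputs and second inputs of `T₀` are three families without
  -- repetition, each of total charge at most `3 P`, and outputs carry the coefficient 3.
  have hsum : (T₀.contractions.map fun p => G.sketchTerm p.1 p.2).sum ≤ K ^ 3 * (15 * P) := by
    rw [← List.sum_toFinset _ (ContractionTree.nodup_contractions hT₀.1)]
    refine (Finset.sum_le_sum fun p hp => hterm p (List.mem_toFinset.1 hp)).trans ?_
    rw [← Finset.mul_sum, Finset.sum_add_distrib, Finset.sum_add_distrib, ← Finset.mul_sum]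
    gcongr
    linarith [hinj _ (ContractionTree.union_injOn hT₀.1), hinj _ (ContractionTree.fst_injOn hT₀.1),
      hinj _ (ContractionTree.snd_injOn hT₀.1)]
  rw [one_div, inv_mul_le_iff₀ (by positivity)]
  linarith
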